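/- **Setting.** Let $D\subseteq\mathbb R^n$ be nonempty, open and convex, and let $f:D\to\mathbb R$ be convex and three times continuously differentiable. Write $\|u\|_x:=(u^T\nabla^2 f(x)u)^{1/2}$ for $x\in D$. Suppose that $f$ is a $\nu$-self-concordant barrier, $\nu>0$: for all $x\in D$ and $v\in\mathbb R^n$, the function $\varphi(\tau)=f(x+\tau v)$ satisfies $|\varphi'''(\tau)|\le 2\varphi''(\tau)^{3/2}$ whenever $x+\tau v\in D$, and $2\nabla f(x)^Tu-\|u\|_x^2\le\nu$ for all $x\in D$, $u\in\mathbb R^n$. Let $\Omega=\overline{D}$, let $g:\mathbb R^n\to\mathbb R\cup\{+\infty\}$ be proper, lower semicontinuous and convex, and put $\operatorname{dom}F=D\cap\{g<+\infty\}$. Let $\mathbf x^*$ be a solution of $\min_{x\in\Omega}g(x)$. For $t>0$ let $\mathbf x^*_t$ denote a solution (assumed to exist wherever it is mentioned) of $$\min_{x\in\operatorname{dom}F}\ F(x;t):=f(x)+t^{-1}g(x).$$ For $c\in D$ let $\widehat F(x;t,c):=f(c)+\nabla f(c)^T(x-c)+\tfrac12(x-c)^T\nabla^2f(c)(x-c)+t^{-1}g(x)$.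 A point $y\in\operatorname{dom}F$ is called a $\delta$-solution of $\min_{x\in\operatorname{dom}F}\widehat F(x;t,c)$ if $\widehat F(y;t,c)-\inf_{x\in\operatorname{dom}F}\widehat F(x;t,c)\le\delta^2/2$. **Algorithm.** Let $\omega(\tau)=\tau-\ln(1+\tau)$, $C(\beta)=\frac{\sqrt\beta-2.581\beta}{2.581+\sqrt\beta}$, $\sigma_\beta=\frac{C(\beta)}{(1+C(\beta))\sqrt\nu}$. Input: $t_0>0$, $\beta\in(0,0.15]$, $\kappa\in(0,1)$, $\mathbf x^0\in\operatorname{dom}F$, and $\gamma_0>0$ with $F(\mathbf x^0;t_0)-\inf_{\operatorname{dom} F} F(\cdot;t_0)\le\gamma_0$. *Phase I.* Start from $\mathbf x^0_{t_0}=\mathbf x^0$. For $j=0,1,\dots$ compute a $(\kappa\beta)$-solution $\mathbf s^j$ of $\min_{\operatorname{dom} F}\widehat F(\cdot;t_0,\mathbf x^j_{t_0})$ and set $\mathbf d^j=\mathbf s^j-\mathbf x^j_{t_0}$, $\zeta_j=\|\mathbf d^j\|_{\mathbf x^j_{t_0}}$, $\Gamma_j=\omega(\beta)+\sum_{l\le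 j}\omega((1-\kappa)\zeta_l)$. If $\Gamma_j\ge\gamma_0$, stop with $\mathbf x_{t_0}:=\mathbf x^j_{t_0}$; otherwise set $\mathbf x^{j+1}_{t_0}=\mathbf x^j_{t_0}+\frac{1-\kappa}{1+(1-\kappa)\zeta_j}\mathbf d^j$. *Phase II.* For $k=1,2,\dots,K$ set $t_k=(1\pm\sigma_\beta)t_{k-1}$ (either sign; all $t_k$ are required to be positive), and let $\mathbf x_{t_k}$ be a $\delta_k$-solution of $\min_{\operatorname{dom} F}\widehat F(\cdot;t_k,\mathbf x_{t_{k-1}})$, where $0\le\delta_k\le0.075\beta$. **Lemma.** 1. For every $t>0$, $\mathbf x^*_t\in\operatorname{int}(\Omega)$ (strict feasibility) and $$0\le g(\mathbf x^*_t)-g(\mathbf x^*)\le t\nu .$$ 2. Let $\mathbf x_{t_k}$ be generated by the algorithm. For every $0\le k\le K$, $$g(\mathbf x_{t_k})-g(\mathbf x^*)\ge0\quad\text{and}\quad g(\mathbf x_{t_k})-g(\mathbf x^*_{t_k})\ge-\nu t_k .$$ For $1\le k\le K$ put $\lambda_{t_k}=\|\mathbf x_{t_{k-1}}-\mathbf x^*_{t_k}\|_{\mathbf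 x^*_{t_k}}$ and $\lambda^+_{t_k}=\|\mathbf x_{t_k}-\mathbf x^*_{t_k}\|_{\mathbf x^*_{t_k}}$. If $\lambda_{t_k}<1$, then $$g(\mathbf x_{t_k})-g(\mathbf x^*_{t_k})\le t_k\left(\sqrt\nu\,\frac{\lambda^+_{t_k}}{1-\lambda_{t_k}}+\frac{\lambda_{t_k}}{(1-\lambda_{t_k})^2}\left(\lambda^+_{t_k}+\lambda_{t_k}+\delta_k\right)+\frac{\delta_k^2}{2}\right)$$ and consequently $$0\le g(\mathbf x_{t_k})-g(\mathbf x^*)\le t_k\,\psi(\nu,\lambda_{t_k},\lambda^+_{t_k},\delta_k),$$ where $$\psi(\nu,\lambda,\lambda^+,\delta):=\nu+\sqrt\nu\,\frac{\lambda^+}{1-\lambda}+\frac{\lambda}{(1-\lambda)^2}\left(\lambda^++\lambda+\delta\right)+\frac{\delta^2}{2}.$$ -/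

import Mathlib

namespace ProxPath

noncomputable section

/-- The quadratic form `uᵀ ∇²f(x) u`. -/
def hessForm {n : ℕ} (f : EuclideanSpace ℝ (Fin n) → ℝ) (x u : EuclideanSpace ℝ (Fin n)) : ℝ :=
  fderiv ℝ (fderiv ℝ f) x u u

/-- The local norm `‖u‖_x = (uᵀ ∇²f(x) u)^{1/2}`. -/
def localNorm {n : ℕ} (f : EuclideanSpace ℝ (Fin n) → ℝ) (x u : EuclideanSpace ℝ (Fin n)) : ℝ :=
  Real.sqrt (hessForm f x u)

/-- `f`, with `dom f = D`, is a standard self-concordant function: a convex function of class `C³`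
on a nonempty open convex set `D`, each of whose restrictions `φ(τ) = f(x + τ v)` to a line
satisfies `|φ'''| ≤ 2 (φ'')^{3/2}`. (A function with values in `ℝ ∪ {+∞}` is represented by its
domain `D` and its values on `D`; no value outside `D` is ever used.) -/
structure IsSelfConcordant {n : ℕ} (D : Set (EuclideanSpace ℝ (Fin n)))
    (f : EuclideanSpace ℝ (Fin n) → ℝ) : Prop where
  nonempty : D.Nonempty
  isOpen : IsOpen D
  convexOn : ConvexOn ℝ D f
  contDiffOn : ContDiffOn ℝ 3 f D
  third_le : ∀ x ∈ D, ∀ (v : EuclideanSpace ℝ (Fin n)) (τ : ℝ), x + τ • v ∈ D →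
    |iteratedDeriv 3 (fun r : ℝ => f (x + r • v)) τ|
      ≤ 2 * (iteratedDeriv 2 (fun r : ℝ => f (x + r • v)) τ) ^ (3 / 2 : ℝ)

/-- `f`, with `dom f = D`, is a `ν`-self-concordant barrier (for the closure of `D`):
`sup_u {2 ∇f(x)ᵀu - ‖u‖_x²} ≤ ν` at every `x ∈ D`. -/
structure IsSelfConcordantBarrier {n : ℕ} (D : Set (EuclideanSpace ℝ (Fin n)))
    (f : EuclideanSpace ℝ (Fin n) → ℝ) (ν : ℝ) : Prop where
  selfConcordant : IsSelfConcordant D f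
  pos : 0 < ν
  barrier_le : ∀ x ∈ D, ∀ u : EuclideanSpace ℝ (Fin n),
    2 * fderiv ℝ f x u - hessForm f x u ≤ ν

/-- `g : ℝⁿ → ℝ ∪ {+∞}` is proper, lower semicontinuous and convex (its epigraph is convex). -/
structure IsProperLscConvex {n : ℕ} (g : EuclideanSpace ℝ (Fin n) → EReal) : Prop where
  ne_bot : ∀ x, g x ≠ ⊥
  exists_ne_top : ∃ x, g x ≠ ⊤
  lsc : LowerSemicontinuous g
  convex_epigraph : Convex ℝ {p : EuclideanSpace ℝ (Fin n) × ℝ | g p.1 ≤ (p.2 : EReal)}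

/-- `dom F = dom f ∩ dom g`, where `dom f = D` and `dom g = {g < +∞}`. -/
def domF {n : ℕ} (D : Set (EuclideanSpace ℝ (Fin n)))
    (g : EuclideanSpace ℝ (Fin n) → EReal) : Set (EuclideanSpace ℝ (Fin n)) :=
  D ∩ {x | g x < ⊤}

/-- The penalized objective `F(x; t) = f(x) + t⁻¹ g(x)`, to be used on `dom F` only. -/
def penalized {n : ℕ} (f : EuclideanSpace ℝ (Fin n) → ℝ) (g : EuclideanSpace ℝ (Fin n) → EReal)
    (t : ℝ) (x : EuclideanSpace ℝ (Fin n)) : ℝ :=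
  f x + t⁻¹ * (g x).toReal

/-- `y` solves the penalized problem `min_x F(x; t)`. -/
def IsPenalizedSolution {n : ℕ} (D : Set (EuclideanSpace ℝ (Fin n)))
    (f : EuclideanSpace ℝ (Fin n) → ℝ) (g : EuclideanSpace ℝ (Fin n) → EReal)
    (t : ℝ) (y : EuclideanSpace ℝ (Fin n)) : Prop :=
  y ∈ domF D g ∧ IsMinOn (penalized f g t) (domF D g) y

/-- `y` solves the constrained problem `min_{x ∈ Ω} g(x)`. -/
def IsConstrainedSolution {n : ℕ} (Ω : Set (EuclideanSpace ℝ (Fin n)))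
    (g : EuclideanSpace ℝ (Fin n) → EReal) (y : EuclideanSpace ℝ (Fin n)) : Prop :=
  y ∈ Ω ∧ IsMinOn g Ω y

/-- The quadratic model `Q(x; c) = f(c) + ∇f(c)ᵀ(x - c) + ½ (x - c)ᵀ ∇²f(c) (x - c)`. -/
def quadModel {n : ℕ} (f : EuclideanSpace ℝ (Fin n) → ℝ) (c x : EuclideanSpace ℝ (Fin n)) : ℝ :=
  f c + fderiv ℝ f c (x - c) + (1 / 2) * hessForm f c (x - c)

/-- The composite model `F̂(x; t, c) = Q(x; c) + t⁻¹ g(x)`, to be used on `dom F` only. -/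
def compositeModel {n : ℕ} (f : EuclideanSpace ℝ (Fin n) → ℝ)
    (g : EuclideanSpace ℝ (Fin n) → EReal) (t : ℝ) (c x : EuclideanSpace ℝ (Fin n)) : ℝ :=
  quadModel f c x + t⁻¹ * (g x).toReal

/-- `y` is a `δ`-solution of the subproblem `min_{x ∈ dom F} F̂(x; t, c)`: it lies in `dom F` and its
model value exceeds the optimal one by at most `δ²/2`. The optimal value is taken as an infimum, so
that no exact minimizer has to exist; see `isInexactSolution_iff` for the case where there is one. -/
def IsInexactSolution {n : ℕ} (D : Set (EuclideanSpace ℝ (Fin n)))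
    (f : EuclideanSpace ℝ (Fin n) → ℝ) (g : EuclideanSpace ℝ (Fin n) → EReal)
    (t δ : ℝ) (c y : EuclideanSpace ℝ (Fin n)) : Prop :=
  y ∈ domF D g ∧
    ∀ z ∈ domF D g, compositeModel f g t c y - compositeModel f g t c z ≤ δ ^ 2 / 2

/-- If the subproblem has an exact solution `xbar`, then `y ∈ dom F` is a `δ`-solution exactly when
`F̂(y; t, c) - F̂(xbar; t, c) ≤ δ²/2`. -/
theorem isInexactSolution_iff {n : ℕ} {D : Set (EuclideanSpace ℝ (Fin n))}
    {f : EuclideanSpace ℝ (Fin n) → ℝ} {g : EuclideanSpace ℝ (Fin n) → EReal}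
    {t δ : ℝ} {c y xbar : EuclideanSpace ℝ (Fin n)} (hmem : xbar ∈ domF D g)
    (hmin : IsMinOn (compositeModel f g t c) (domF D g) xbar) :
    IsInexactSolution D f g t δ c y ↔
      y ∈ domF D g ∧ compositeModel f g t c y - compositeModel f g t c xbar ≤ δ ^ 2 / 2 :=
  ⟨fun h => ⟨h.1, h.2 xbar hmem⟩, fun h => ⟨h.1, fun z hz => by
    have h1 : compositeModel f g t c xbar ≤ compositeModel f g t c z := hmin hz
    linarith [h.2]⟩⟩

/-- `ω(τ) = τ - ln(1 + τ)`. -/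
def omega (τ : ℝ) : ℝ := τ - Real.log (1 + τ)

/-- `C(β) = (√β - 2.581 β) / (2.581 + √β)`. -/
def cBeta (β : ℝ) : ℝ := (Real.sqrt β - 2.581 * β) / (2.581 + Real.sqrt β)

/-- `σ_β = C(β) / ((1 + C(β)) √ν)`. -/
def sigmaBeta (β ν : ℝ) : ℝ := cBeta β / ((1 + cBeta β) * Real.sqrt ν)

/-- A run of the inexact path-following proximal-Newton algorithm, carried through Phase I and
through `K` iterations of Phase II. -/
structure PathFollowingRun {n : ℕ} (D : Set (EuclideanSpace ℝ (Fin n)))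
    (f : EuclideanSpace ℝ (Fin n) → ℝ) (g : EuclideanSpace ℝ (Fin n) → EReal) (ν : ℝ) where
  /-- number of Phase II iterations -/
  K : ℕ
  /-- penalty parameters `t₀, …, t_K` -/
  t : ℕ → ℝ
  /-- Phase II points: `x k` is `x_{t_k}` -/
  x : ℕ → EuclideanSpace ℝ (Fin n)
  /-- accuracies: `δ k` is the accuracy with which `x k` is computed, `1 ≤ k ≤ K` -/
  δ : ℕ → ℝ
  β : ℝ
  κ : ℝ
  γ₀ : ℝ
  /-- index at which Phase I stops -/
  J : ℕ
  /-- Phase I points: `z j` is `x^j_{t₀}` -/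
  z : ℕ → EuclideanSpace ℝ (Fin n)
  /-- Phase I trial points -/
  s : ℕ → EuclideanSpace ℝ (Fin n)
  /- input -/
  t_pos : ∀ k ≤ K, 0 < t k
  β_pos : 0 < β
  β_le : β ≤ 0.15
  κ_pos : 0 < κ
  κ_lt_one : κ < 1
  z_zero_mem : z 0 ∈ domF D g
  γ₀_pos : 0 < γ₀
  /-- `γ₀` bounds `F(x⁰; t₀) - min F(·; t₀)` from above -/
  gap_le : ∀ y ∈ domF D g, penalized f g (t 0) (z 0) - penalized f g (t 0) y ≤ γ₀
  /- Phase I: the direction is `d^j = s^j - x^j`, with `ζ_j = ‖d^j‖_{x^j}` -/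
  trial : ∀ j ≤ J, IsInexactSolution D f g (t 0) (κ * β) (z j) (s j)
  /-- `Γ_j < γ₀` before the last Phase I iteration -/
  continue_cond : ∀ j < J,
    omega β + ∑ l ∈ Finset.range (j + 1), omega ((1 - κ) * localNorm f (z l) (s l - z l)) < γ₀
  /-- `Γ_J ≥ γ₀` at the last Phase I iteration -/
  stop_cond :
    γ₀ ≤ omega β + ∑ l ∈ Finset.range (J + 1), omega ((1 - κ) * localNorm f (z l) (s l - z l))
  /-- damped step with `α_j = (1 - κ) / (1 + (1 - κ) ζ_j)` -/
  damped_step : ∀ j < J,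
    z (j + 1) = z j
      + ((1 - κ) / (1 + (1 - κ) * localNorm f (z j) (s j - z j))) • (s j - z j)
  /- Phase II -/
  x_zero : x 0 = z J
  t_succ : ∀ k < K, t (k + 1) = (1 + sigmaBeta β ν) * t k ∨ t (k + 1) = (1 - sigmaBeta β ν) * t k
  δ_nonneg : ∀ k < K, 0 ≤ δ (k + 1)
  δ_le : ∀ k < K, δ (k + 1) ≤ 0.075 * β
  x_succ : ∀ k < K, IsInexactSolution D f g (t (k + 1)) (δ (k + 1)) (x k) (x (k + 1))

/-- `√ν λ⁺/(1 - λ) + λ/(1 - λ)² (λ⁺ + λ + δ) + δ²/2`. -/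
def gapBound (ν lam lamPlus δ : ℝ) : ℝ :=
  Real.sqrt ν * (lamPlus / (1 - lam)) + lam / (1 - lam) ^ 2 * (lamPlus + lam + δ) + δ ^ 2 / 2

/-- `ψ(ν, λ, λ⁺, δ) = ν + √ν λ⁺/(1 - λ) + λ/(1 - λ)² (λ⁺ + λ + δ) + δ²/2`. -/
def psi (ν lam lamPlus δ : ℝ) : ℝ :=
  ν + Real.sqrt ν * (lamPlus / (1 - lam)) + lam / (1 - lam) ^ 2 * (lamPlus + lam + δ) + δ ^ 2 / 2

end

end ProxPath

/-! Everything rests on two inequalities for the barrier. The first is `fderiv_sub_le`: the slope of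
`f` from `x` towards any point of `closure D` is at most `ν`. Optimality of `x*_t`, tested along the
segment to `z`, gives `g(x*_t) - g(z) ≤ t ∇f(x*_t)ᵀ(z - x*_t) ≤ tν`. Taking `z = x*` yields part 1,
and `z = x_{t_k}` yields the lower bound in part 2.

For the upper bound in part 2, compare the model centred at `c = x_{t_{k-1}}` at the inexact
solution `y` and at `x*_t`. The difference of linear terms costs `√ν ‖y - x*_t‖_c`, that of
quadratic terms at most `‖c - x*_t‖_c ‖y - x*_t‖_c`. The second inequality, `localNorm_le`, replaces
norms at `c` by norms at `x*_t` at the price of a factor `1/(1 - λ)`. Adding part 1 gives the bound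
with `ψ`.

Comparing norms at two points needs `|D³f[h,v,v]| ≤ 2‖h‖‖v‖²`, whereas self-concordance controls
only `D³f[v,v,v]`. This polarization without loss of constant is `abs_trilinear_le`. -/

open Filter Topology

/-! ### Polarization of symmetric trilinear forms -/

namespace ProxPath

/-- A cubic form in the plane with coefficients `A, 3B, 3C, D`, polarized at `(cos 3ψ, sin 3ψ)` and
twice at `(1, 0)`, is a nonnegative combination of its values at the three unit vectors with angles
`ψ`, `ψ + 2π/3`, `ψ - 2π/3`. Here `c = cos ψ`, `s = sin ψ` and `r = √3`. -/
theorem cubic_polarization_identity (A B C D c s r : ℝ) (hr : r ^ 2 = 3) (hcs : c ^ 2 + s ^ 2 = 1) :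
    (4 * c ^ 3 - 3 * c) * A + (3 * s - 4 * s ^ 3) * B =
      1 / 9 * (3 * c ^ 2 - s ^ 2) ^ 2 *
        (c ^ 3 * A + 3 * c ^ 2 * s * B + 3 * c * s ^ 2 * C + s ^ 3 * D) +
      4 / 9 * (s * (s + r * c)) ^ 2 *
        ((-c / 2 - r * s / 2) ^ 3 * A + 3 * (-c / 2 - r * s / 2) ^ 2 * (-s / 2 + r * c / 2) * B +
          3 * (-c / 2 - r * s / 2) * (-s / 2 + r * c / 2) ^ 2 * C + (-s / 2 + r * c / 2) ^ 3 * D) +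
      4 / 9 * (s * (s - r * c)) ^ 2 *
        ((-c / 2 + r * s / 2) ^ 3 * A + 3 * (-c / 2 + r * s / 2) ^ 2 * (-s / 2 - r * c / 2) * B +
          3 * (-c / 2 + r * s / 2) * (-s / 2 - r * c / 2) ^ 2 * C +
            (-s / 2 - r * c / 2) ^ 3 * D) := by
  have h4 : r ^ 4 = 9 := by rw [show r ^ 4 = (r ^ 2) ^ 2 by ring, hr]; norm_num
  -- Powers of `c² + s² = 1` make both sides homogeneous of degree 7 in `c, s`; the identity is then
  -- polynomial modulo `r² = 3`.
  have hA : 4 * c ^ 3 - 3 * c = (4 * c ^ 3 - 3 * c * (c ^ 2 + s ^ 2)) * (c ^ 2 + s ^ 2) ^ 2 := by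
    rw [hcs]; ring
  have hB : 3 * s - 4 * s ^ 3 = (3 * s * (c ^ 2 + s ^ 2) - 4 * s ^ 3) * (c ^ 2 + s ^ 2) ^ 2 := by
    rw [hcs]; ring
  rw [hA, hB]
  ring_nf
  simp only [hr, h4]
  ring

/-- The weights are `(sin 3φ / (3 sin φ))²`, with the division carried out, for the three angles
`φ`. Total mass one makes the identity above a convex combination, so no constant is lost. -/
theorem cubic_weights_sum (c s r : ℝ) (hr : r ^ 2 = 3) (hcs : c ^ 2 + s ^ 2 = 1) :
    1 / 9 * (3 * c ^ 2 - s ^ 2) ^ 2 + 4 / 9 * (s * (s + r * c)) ^ 2 +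
      4 / 9 * (s * (s - r * c)) ^ 2 = 1 := by
  linear_combination (8 / 9 * s ^ 2 * c ^ 2) * hr + (c ^ 2 + s ^ 2 + 1) * hcs

section Trilinear

variable {E : Type*} [NormedAddCommGroup E] [InnerProductSpace ℝ E]

theorem abs_trilinear_le_of_orthogonal {T : E →L[ℝ] E →L[ℝ] E →L[ℝ] ℝ}
    (h12 : ∀ a b c, T a b c = T b a c) (h23 : ∀ a b c, T a b c = T a c b)
    {B : E →ₗ[ℝ] E →ₗ[ℝ] ℝ} (hB : ∀ a b, B a b = B b a) {M : ℝ}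
    (hT : ∀ u, B u u ≤ 1 → |T u u u| ≤ M) {v e : E} (hv : B v v ≤ 1) (he : B e e ≤ 1)
    (hve : B v e = 0) (θ : ℝ) :
    |Real.cos θ * T v v v + Real.sin θ * T e v v| ≤ M := by
  have key : ∀ x y : ℝ, x ^ 2 + y ^ 2 = 1 →
      |x ^ 3 * T v v v + 3 * x ^ 2 * y * T e v v + 3 * x * y ^ 2 * T e e v + y ^ 3 * T e e e|
        ≤ M := by
    intro x y hxy
    have h1 : B (x • v + y • e) (x • v + y • e) ≤ 1 := by
      have : B (x • v + y • e) (x • v + y • e) = x ^ 2 * B v v + y ^ 2 * B e e := by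
        simp only [map_add, map_smul, LinearMap.add_apply, LinearMap.smul_apply, smul_eq_mul,
          hB e v, hve]
        ring
      rw [this]
      nlinarith [mul_le_mul_of_nonneg_left hv (sq_nonneg x),
        mul_le_mul_of_nonneg_left he (sq_nonneg y)]
    have h2 := hT _ h1
    have h3 : T (x • v + y • e) (x • v + y • e) (x • v + y • e) =
        x ^ 3 * T v v v + 3 * x ^ 2 * y * T e v v + 3 * x * y ^ 2 * T e e v + y ^ 3 * T e e e := by
      simp only [map_add, map_smul, _root_.add_apply, _root_.smul_apply,
        smul_eq_mul, h12 v e, h23 v v e, h23 e v e]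
      ring
    rwa [h3] at h2
  -- Trisecting the angle: the three vectors of the identity lie at `θ/3` and `θ/3 ± 2π/3`.
  obtain ⟨ψ, rfl⟩ : ∃ ψ, θ = 3 * ψ := ⟨θ / 3, by ring⟩
  have hr : Real.sqrt 3 ^ 2 = 3 := Real.sq_sqrt (by norm_num)
  have hcs : Real.cos ψ ^ 2 + Real.sin ψ ^ 2 = 1 := Real.cos_sq_add_sin_sq ψ
  rw [Real.cos_three_mul, Real.sin_three_mul]
  generalize Real.cos ψ = c at *
  generalize Real.sin ψ = s at *
  generalize Real.sqrt 3 = r at *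
  rw [cubic_polarization_identity _ _ (T e e v) (T e e e) c s r hr hcs]
  have k0 := key c s hcs
  have k1 := key (-c / 2 - r * s / 2) (-s / 2 + r * c / 2)
    (by linear_combination ((c ^ 2 + s ^ 2) / 4) * hr + hcs)
  have k2 := key (-c / 2 + r * s / 2) (-s / 2 - r * c / 2)
    (by linear_combination ((c ^ 2 + s ^ 2) / 4) * hr + hcs)
  have hw := cubic_weights_sum c s r hr hcs
  have p0 : 0 ≤ 1 / 9 * (3 * c ^ 2 - s ^ 2) ^ 2 := by positivity
  have p1 : 0 ≤ 4 / 9 * (s * (s + r * c)) ^ 2 := by positivity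
  have p2 : 0 ≤ 4 / 9 * (s * (s - r * c)) ^ 2 := by positivity
  rw [abs_le] at k0 k1 k2 ⊢
  have l0 := mul_le_mul_of_nonneg_left k0.1 p0
  have l1 := mul_le_mul_of_nonneg_left k1.1 p1
  have l2 := mul_le_mul_of_nonneg_left k2.1 p2
  have u0 := mul_le_mul_of_nonneg_left k0.2 p0
  have u1 := mul_le_mul_of_nonneg_left k1.2 p1
  have u2 := mul_le_mul_of_nonneg_left k2.2 p2
  have hM := congrArg (· * M) hw
  simp only [add_mul, one_mul] at hM
  constructor <;> linarith

/-- Gram–Schmidt: `h = cos θ • v + sin θ • e` with `θ = arccos (B h v)` and `e` orthogonal to `v`.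
-/
theorem abs_trilinear_le_of_unit {T : E →L[ℝ] E →L[ℝ] E →L[ℝ] ℝ}
    (h12 : ∀ a b c, T a b c = T b a c) (h23 : ∀ a b c, T a b c = T a c b)
    {B : E →ₗ[ℝ] E →ₗ[ℝ] ℝ} (hB : ∀ a b, B a b = B b a) (hpos : ∀ u, u ≠ 0 → 0 < B u u) {M : ℝ}
    (hT : ∀ u, B u u ≤ 1 → |T u u u| ≤ M) {h v : E} (hv : B v v = 1) (hh : B h h = 1) :
    |T h v v| ≤ M := by
  have hnn : ∀ u, 0 ≤ B u u := fun u => by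
    rcases eq_or_ne u 0 with rfl | hu
    · simp
    · exact (hpos u hu).le
  set a := B h v with ha
  set w := h - a • v with hw
  have hvw : B v w = 0 := by simp [hw, hv, hB v h, ← ha]
  have hww : B w w = 1 - a ^ 2 := by
    simp only [hw, map_sub, map_smul, LinearMap.sub_apply, LinearMap.smul_apply, smul_eq_mul,
      hv, hh, hB v h, ← ha]
    ring
  have ha1 : 0 ≤ 1 - a ^ 2 := hww ▸ hnn w
  have hcos : Real.cos (Real.arccos a) = a :=
    Real.cos_arccos (by nlinarith) (by nlinarith)
  have hsin : Real.sin (Real.arccos a) = √(1 - a ^ 2) := Real.sin_arccos a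
  set S := √(1 - a ^ 2) with hS
  have hS2 : S ^ 2 = 1 - a ^ 2 := Real.sq_sqrt ha1
  -- If `S = 0`, definiteness forces `w = 0`, and `S⁻¹ = 0` makes `e = 0`. Hence only `B e e ≤ 1` is
  -- claimed below.
  have hSw : S • S⁻¹ • w = w := by
    rcases eq_or_ne S 0 with h0 | h0
    · have : w = 0 := by
        by_contra hne
        have := hpos w hne
        rw [hww, ← hS2, h0] at this
        simp at this
      simp [this]
    · rw [smul_smul, mul_inv_cancel₀ h0, one_smul]
  have he : B (S⁻¹ • w) (S⁻¹ • w) ≤ 1 := by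
    simp only [map_smul, LinearMap.smul_apply, smul_eq_mul, hww, ← hS2]
    rcases eq_or_ne S 0 with h0 | h0
    · simp [h0]
    · field_simp
      norm_num
  have hve : B v (S⁻¹ • w) = 0 := by simp [hvw]
  have := abs_trilinear_le_of_orthogonal h12 h23 hB hT hv.le he hve (Real.arccos a)
  rw [hcos, hsin] at this
  have hh' : h = a • v + S • S⁻¹ • w := by rw [hSw, hw]; abel
  have e1 : T h v v = a * T v v v + S * T (S⁻¹ • w) v v := by
    conv_lhs => rw [hh']
    rw [map_add, map_smul, map_smul]
    simp
  rwa [e1]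

theorem abs_trilinear_le_of_posDef {T : E →L[ℝ] E →L[ℝ] E →L[ℝ] ℝ}
    (h12 : ∀ a b c, T a b c = T b a c) (h23 : ∀ a b c, T a b c = T a c b)
    {B : E →ₗ[ℝ] E →ₗ[ℝ] ℝ} (hB : ∀ a b, B a b = B b a) (hpos : ∀ u, u ≠ 0 → 0 < B u u) {M : ℝ}
    (hM : 0 ≤ M) (hT : ∀ u, |T u u u| ≤ M * √(B u u) ^ 3) (h v : E) :
    |T h v v| ≤ M * √(B h h) * B v v := by
  rcases eq_or_ne h 0 with rfl | hh0
  · simp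
  rcases eq_or_ne v 0 with rfl | hv0
  · simp
  have normalize : ∀ u, u ≠ 0 → 0 < √(B u u) ∧ B ((√(B u u))⁻¹ • u) ((√(B u u))⁻¹ • u) = 1 ∧
      u = √(B u u) • (√(B u u))⁻¹ • u := by
    intro u hu
    have h0 := hpos u hu
    have h1 := Real.sqrt_pos.2 h0
    refine ⟨h1, ?_, by rw [smul_smul, mul_inv_cancel₀ h1.ne', one_smul]⟩
    have h2 := Real.sq_sqrt h0.le
    simp only [map_smul, LinearMap.smul_apply, smul_eq_mul]
    field_simp
    linarith
  obtain ⟨ph, uh, eh⟩ := normalize h hh0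
  obtain ⟨pv, uv, ev⟩ := normalize v hv0
  have hT1 : ∀ u, B u u ≤ 1 → |T u u u| ≤ M := fun u hu => (hT u).trans <| by
    have : √(B u u) ^ 3 ≤ 1 := pow_le_one₀ (Real.sqrt_nonneg _) (Real.sqrt_le_one.2 hu)
    nlinarith
  have key := abs_trilinear_le_of_unit h12 h23 hB hpos hT1 uv uh
  have hv2 := Real.sq_sqrt (hpos v hv0).le
  generalize √(B h h) = p at *
  generalize √(B v v) = q at *
  have : T h v v = p * q ^ 2 * T (p⁻¹ • h) (q⁻¹ • v) (q⁻¹ • v) := by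
    conv_lhs => rw [eh, ev]
    generalize p⁻¹ • h = h'
    generalize q⁻¹ • v = v'
    simp only [map_smul, _root_.smul_apply, smul_eq_mul]
    ring
  rw [this, abs_mul, abs_of_pos (by positivity), ← hv2]
  nlinarith [mul_le_mul_of_nonneg_left key (by positivity : 0 ≤ p * q ^ 2)]

/-- A symmetric trilinear form bounded on the diagonal by the cube of a seminorm coming from a
positive semidefinite form is bounded by the same constant off the diagonal. -/
theorem abs_trilinear_le {T : E →L[ℝ] E →L[ℝ] E →L[ℝ] ℝ}
    (h12 : ∀ a b c, T a b c = T b a c) (h23 : ∀ a b c, T a b c = T a c b)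
    {B : E →L[ℝ] E →L[ℝ] ℝ} (hB : ∀ a b, B a b = B b a) (hpos : ∀ u, 0 ≤ B u u) {M : ℝ}
    (hM : 0 ≤ M) (hT : ∀ u, |T u u u| ≤ M * √(B u u) ^ 3) (h v : E) :
    |T h v v| ≤ M * √(B h h) * B v v := by
  -- Adding `ε` times the inner product makes `B` definite and only weakens the diagonal bound; then
  -- `ε → 0`.
  have approx : ∀ ε : ℝ, 0 < ε →
      |T h v v| ≤ M * √(B h h + ε * ‖h‖ ^ 2) * (B v v + ε * ‖v‖ ^ 2) := by
    intro ε hε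
    set B' : E →ₗ[ℝ] E →ₗ[ℝ] ℝ := B.toLinearMap₁₂ + ε • innerₗ E with hB'
    have happ : ∀ a b, B' a b = B a b + ε * inner ℝ a b := fun a b => by
      simp [hB']
    have hdiag : ∀ u, B' u u = B u u + ε * ‖u‖ ^ 2 := fun u => by
      rw [happ, real_inner_self_eq_norm_sq]
    have := abs_trilinear_le_of_posDef h12 h23 (B := B')
      (fun a b => by rw [happ, happ, hB, real_inner_comm])
      (fun u hu => by
        rw [hdiag]
        have := hpos u
        have := norm_pos_iff.2 hu
        positivity) hM
      (fun u => (hT u).trans (by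
        rw [hdiag]
        have : B u u ≤ B u u + ε * ‖u‖ ^ 2 := le_add_of_nonneg_right (by positivity)
        gcongr)) h v
    rwa [hdiag, hdiag] at this
  have hlim : Tendsto (fun ε : ℝ => M * √(B h h + ε * ‖h‖ ^ 2) * (B v v + ε * ‖v‖ ^ 2)) (𝓝[>] 0)
      (𝓝 (M * √(B h h) * B v v)) := by
    have hc : Continuous fun ε : ℝ => M * √(B h h + ε * ‖h‖ ^ 2) * (B v v + ε * ‖v‖ ^ 2) := by
      fun_prop
    have := hc.tendsto 0
    simp only [zero_mul, add_zero] at this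
    exact this.mono_left nhdsWithin_le_nhds
  exact ge_of_tendsto hlim (eventually_mem_nhdsWithin.mono fun ε hε => approx ε hε)

end Trilinear

end ProxPath

/-! ### Derivatives along lines and symmetry of the third derivative -/

namespace ProxPath

section LineDerivatives

variable {E F : Type*} [NormedAddCommGroup E] [NormedSpace ℝ E]
  [NormedAddCommGroup F] [NormedSpace ℝ F]

theorem hasDerivAt_comp_line {G : E → F} {x v : E} {τ : ℝ}
    (hG : DifferentiableAt ℝ G (x + τ • v)) :
    HasDerivAt (fun r : ℝ => G (x + r • v)) (fderiv ℝ G (x + τ • v) v) τ := by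
  have h1 : HasDerivAt (fun r : ℝ => x + r • v) v τ := by
    simpa using ((hasDerivAt_id τ).smul_const v).const_add x
  exact hG.hasFDerivAt.comp_hasDerivAt τ h1

theorem hasDerivAt_clm_apply_const {φ : ℝ → E →L[ℝ] F} {φ' : E →L[ℝ] F} {τ : ℝ}
    (h : HasDerivAt φ φ' τ) (b : E) : HasDerivAt (fun r => φ r b) (φ' b) τ := by
  simpa using h.clm_apply (hasDerivAt_const τ b)

variable {D : Set E} {f : E → ℝ}

theorem differentiableAt_fderiv_fderiv (hD : IsOpen D) (hf : ContDiffOn ℝ 3 f D) {x : E}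
    (hx : x ∈ D) :
    DifferentiableAt ℝ f x ∧ DifferentiableAt ℝ (fderiv ℝ f) x ∧
      DifferentiableAt ℝ (fderiv ℝ (fderiv ℝ f)) x := by
  have h3 : ContDiffAt ℝ 3 f x := hf.contDiffAt (hD.mem_nhds hx)
  have h2 : ContDiffAt ℝ 2 (fderiv ℝ f) x := h3.fderiv_right (by norm_num)
  have h1 : ContDiffAt ℝ 1 (fderiv ℝ (fderiv ℝ f)) x := h2.fderiv_right (by norm_num)
  exact ⟨h3.differentiableAt (by norm_num), h2.differentiableAt (by norm_num),
    h1.differentiableAt (by norm_num)⟩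

theorem fderiv_fderiv_comm (hD : IsOpen D) (hf : ContDiffOn ℝ 3 f D) {x : E} (hx : x ∈ D)
    (a b : E) : fderiv ℝ (fderiv ℝ f) x a b = fderiv ℝ (fderiv ℝ f) x b a := by
  have h3 : ContDiffAt ℝ 3 f x := hf.contDiffAt (hD.mem_nhds hx)
  exact h3.isSymmSndFDerivAt (by simp; norm_num) a b

theorem eventually_line_mem (hD : IsOpen D) {x v : E} {τ : ℝ} (hx : x + τ • v ∈ D) :
    ∀ᶠ r : ℝ in 𝓝 τ, x + r • v ∈ D := by
  have hc : Continuous fun r : ℝ => x + r • v := by fun_prop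
  exact hc.continuousAt.eventually_mem (hD.mem_nhds hx)

theorem hasDerivAt_fderiv_line (hD : IsOpen D) (hf : ContDiffOn ℝ 3 f D) {x v : E} {τ : ℝ}
    (hx : x + τ • v ∈ D) (b : E) :
    HasDerivAt (fun r : ℝ => fderiv ℝ f (x + r • v) b)
      (fderiv ℝ (fderiv ℝ f) (x + τ • v) v b) τ := by
  exact hasDerivAt_clm_apply_const
    (hasDerivAt_comp_line (differentiableAt_fderiv_fderiv hD hf hx).2.1) b

theorem hasDerivAt_fderiv_fderiv_line (hD : IsOpen D) (hf : ContDiffOn ℝ 3 f D) {x v : E} {τ : ℝ}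
    (hx : x + τ • v ∈ D) (b c : E) :
    HasDerivAt (fun r : ℝ => fderiv ℝ (fderiv ℝ f) (x + r • v) b c)
      (fderiv ℝ (fderiv ℝ (fderiv ℝ f)) (x + τ • v) v b c) τ := by
  have h := (differentiableAt_fderiv_fderiv hD hf hx).2.2
  generalize fderiv ℝ (fderiv ℝ f) = G at h ⊢
  have h0 := hasDerivAt_comp_line (E := E) (F := E →L[ℝ] E →L[ℝ] ℝ) h
  generalize fderiv ℝ G (x + τ • v) v = L at h0 ⊢
  have h1 : HasDerivAt (fun r : ℝ => G (x + r • v) b) (L b) τ := hasDerivAt_clm_apply_const (F := E →L[ℝ] ℝ) h0 b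
  generalize L b = L' at h1 ⊢
  exact hasDerivAt_clm_apply_const (F := ℝ) h1 c

/-- Differentiate the symmetry of the Hessian along the line in direction `a`. -/
theorem third_fderiv_comm_right (hD : IsOpen D) (hf : ContDiffOn ℝ 3 f D) {x : E} (hx : x ∈ D)
    (a b c : E) : fderiv ℝ (fderiv ℝ (fderiv ℝ f)) x a b c =
      fderiv ℝ (fderiv ℝ (fderiv ℝ f)) x a c b := by
  have hx' : x + (0 : ℝ) • a ∈ D := by simpa using hx
  have h1 := hasDerivAt_fderiv_fderiv_line hD hf hx' b c
  have h2 := hasDerivAt_fderiv_fderiv_line hD hf hx' c b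
  have he : (fun r : ℝ => fderiv ℝ (fderiv ℝ f) (x + r • a) b c) =ᶠ[𝓝 0]
      fun r : ℝ => fderiv ℝ (fderiv ℝ f) (x + r • a) c b :=
    (eventually_line_mem hD hx').mono fun r hr => fderiv_fderiv_comm hD hf hr b c
  have := h1.unique (h2.congr_of_eventuallyEq he)
  simpa using this

theorem third_fderiv_comm_left (hD : IsOpen D) (hf : ContDiffOn ℝ 3 f D) {x : E} (hx : x ∈ D)
    (a b c : E) : fderiv ℝ (fderiv ℝ (fderiv ℝ f)) x a b c =
      fderiv ℝ (fderiv ℝ (fderiv ℝ f)) x b a c := by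
  have h3 : ContDiffAt ℝ 3 f x := hf.contDiffAt (hD.mem_nhds hx)
  have h2 : ContDiffAt ℝ 2 (fderiv ℝ f) x := h3.fderiv_right (by norm_num)
  have := h2.isSymmSndFDerivAt (by simp) a b
  rw [this]

theorem iteratedDeriv_two_line (hD : IsOpen D) (hf : ContDiffOn ℝ 3 f D) {x v : E} {τ : ℝ}
    (hx : x + τ • v ∈ D) :
    iteratedDeriv 2 (fun r : ℝ => f (x + r • v)) τ =
      fderiv ℝ (fderiv ℝ f) (x + τ • v) v v := by
  have he : deriv (fun r : ℝ => f (x + r • v)) =ᶠ[𝓝 τ] fun r => fderiv ℝ f (x + r • v) v :=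
    (eventually_line_mem hD hx).mono fun r hr =>
      (hasDerivAt_comp_line (differentiableAt_fderiv_fderiv hD hf hr).1).deriv
  rw [iteratedDeriv_succ, iteratedDeriv_one, he.deriv_eq]
  exact (hasDerivAt_fderiv_line hD hf hx v).deriv

theorem iteratedDeriv_three_line (hD : IsOpen D) (hf : ContDiffOn ℝ 3 f D) {x v : E} {τ : ℝ}
    (hx : x + τ • v ∈ D) :
    iteratedDeriv 3 (fun r : ℝ => f (x + r • v)) τ =
      fderiv ℝ (fderiv ℝ (fderiv ℝ f)) (x + τ • v) v v v := by
  have he : iteratedDeriv 2 (fun r : ℝ => f (x + r • v)) =ᶠ[𝓝 τ]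
      fun r => fderiv ℝ (fderiv ℝ f) (x + r • v) v v :=
    (eventually_line_mem hD hx).mono fun r hr => iteratedDeriv_two_line hD hf hr
  rw [iteratedDeriv_succ, he.deriv_eq]
  exact (hasDerivAt_fderiv_fderiv_line hD hf hx v v).deriv

end LineDerivatives

/-! ### Inequalities for self-concordant barriers -/

section Barrier

variable {n : ℕ} {D : Set (EuclideanSpace ℝ (Fin n))} {f : EuclideanSpace ℝ (Fin n) → ℝ} {ν : ℝ}

/-- The barrier inequality read as a quadratic in `s`: its leading coefficient gives
semidefiniteness of the Hessian, its discriminant the gradient bound. -/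
theorem IsSelfConcordantBarrier.scaled_le (hf : IsSelfConcordantBarrier D f ν)
    {x : EuclideanSpace ℝ (Fin n)} (hx : x ∈ D) (u : EuclideanSpace ℝ (Fin n)) (s : ℝ) :
    2 * (s * fderiv ℝ f x u) - s ^ 2 * hessForm f x u ≤ ν := by
  have := hf.barrier_le x hx (s • u)
  simp only [hessForm, map_smul, smul_apply, smul_eq_mul] at this ⊢
  linarith

theorem IsSelfConcordantBarrier.hessForm_nonneg (hf : IsSelfConcordantBarrier D f ν)
    {x : EuclideanSpace ℝ (Fin n)} (hx : x ∈ D) (u : EuclideanSpace ℝ (Fin n)) :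
    0 ≤ hessForm f x u := by
  by_contra! hneg
  have h1 := hf.scaled_le hx u
  set h := hessForm f x u
  set d := fderiv ℝ f x u
  have hν := hf.pos
  have key : ∀ s : ℝ, s ^ 2 * (-h) ≤ ν := fun s => by
    have a := h1 s
    have b := h1 (-s)
    nlinarith
  -- This `s` turns the bound into `2ν ≤ ν`.
  have := key (√(2 * ν / (-h)))
  rw [Real.sq_sqrt (div_nonneg (by linarith) (by linarith)),
    div_mul_cancel₀ _ (by linarith)] at this
  linarith

theorem IsSelfConcordantBarrier.sq_fderiv_le (hf : IsSelfConcordantBarrier D f ν)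
    {x : EuclideanSpace ℝ (Fin n)} (hx : x ∈ D) (u : EuclideanSpace ℝ (Fin n)) :
    fderiv ℝ f x u ^ 2 ≤ ν * hessForm f x u := by
  have h := discrim_le_zero (a := hessForm f x u) (b := -2 * fderiv ℝ f x u) (c := ν)
    (fun s => by nlinarith [hf.scaled_le hx u s])
  rw [discrim] at h
  linarith

theorem IsSelfConcordantBarrier.abs_fderiv_le (hf : IsSelfConcordantBarrier D f ν)
    {x : EuclideanSpace ℝ (Fin n)} (hx : x ∈ D) (u : EuclideanSpace ℝ (Fin n)) :
    |fderiv ℝ f x u| ≤ √ν * localNorm f x u := by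
  rw [localNorm, ← Real.sqrt_mul hf.pos.le]
  exact Real.abs_le_sqrt (hf.sq_fderiv_le hx u)

theorem IsSelfConcordantBarrier.abs_third_fderiv_le (hf : IsSelfConcordantBarrier D f ν)
    {x : EuclideanSpace ℝ (Fin n)} (hx : x ∈ D) (h v : EuclideanSpace ℝ (Fin n)) :
    |fderiv ℝ (fderiv ℝ (fderiv ℝ f)) x h v v| ≤ 2 * localNorm f x h * hessForm f x v := by
  have hD := hf.selfConcordant.isOpen
  have hc := hf.selfConcordant.contDiffOn
  refine abs_trilinear_le (third_fderiv_comm_left hD hc hx) (third_fderiv_comm_right hD hc hx)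
    (fderiv_fderiv_comm hD hc hx) (hf.hessForm_nonneg hx) (by norm_num) (fun u => ?_) h v
  have hx' : x + (0 : ℝ) • u ∈ D := by simpa using hx
  have := hf.selfConcordant.third_le x hx u 0 hx'
  rw [iteratedDeriv_two_line hD hc hx', iteratedDeriv_three_line hD hc hx'] at this
  simp only [zero_smul, add_zero] at this
  refine this.trans_eq ?_
  have hnn : 0 ≤ fderiv ℝ (fderiv ℝ f) x u u := hf.hessForm_nonneg hx u
  rw [Real.sqrt_eq_rpow, ← Real.rpow_natCast, ← Real.rpow_mul hnn]
  norm_num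

theorem IsSelfConcordant.convex (hf : IsSelfConcordant D f) : Convex ℝ D := hf.convexOn.1

theorem segment_mem (hD : Convex ℝ D) {x y : EuclideanSpace ℝ (Fin n)} (hx : x ∈ D) (hy : y ∈ D)
    {τ : ℝ} (h0 : 0 ≤ τ) (h1 : τ ≤ 1) : x + τ • (y - x) ∈ D :=
  hD.add_smul_sub_mem hx hy ⟨h0, h1⟩

/-- Along a segment of local length less than `lam < 1`, the squared local norm of the direction
grows at most like `(lam / (1 - τ lam))²`. -/
theorem IsSelfConcordantBarrier.localNorm_segment_le (hf : IsSelfConcordantBarrier D f ν)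
    {x y : EuclideanSpace ℝ (Fin n)} (hx : x ∈ D) (hy : y ∈ D) {lam : ℝ}
    (hlt : localNorm f x (y - x) < lam) (hlam : lam < 1) {τ : ℝ} (h0 : 0 ≤ τ) (h1 : τ ≤ 1) :
    localNorm f (x + τ • (y - x)) (y - x) ≤ lam / (1 - τ * lam) := by
  have hD := hf.selfConcordant.isOpen
  have hc := hf.selfConcordant.contDiffOn
  have hlam0 : 0 < lam := (Real.sqrt_nonneg _).trans_lt hlt
  set a := y - x with ha
  set P : ℝ → ℝ := fun r => hessForm f (x + r • a) a with hP
  have hmem : ∀ r ∈ Set.Icc (0 : ℝ) 1, x + r • a ∈ D := fun r hr =>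
    segment_mem hf.selfConcordant.convex hx hy hr.1 hr.2
  have hPnn : ∀ r ∈ Set.Icc (0 : ℝ) 1, 0 ≤ P r := fun r hr => hf.hessForm_nonneg (hmem r hr) a
  -- The shift keeps `P + ε` positive where `P` vanishes, and makes `√(P 0 + ε)` exactly `lam`.
  set ε := lam ^ 2 - P 0 with hε
  have hεpos : 0 < ε := by
    have h00 := hPnn 0 (by simp)
    have : √(P 0) < lam := by simpa [hP, localNorm] using hlt
    have := (Real.sqrt_lt' hlam0).1 this
    linarith
  have hd : ∀ r ∈ Set.Icc (0 : ℝ) 1, HasDerivAt P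
      (fderiv ℝ (fderiv ℝ (fderiv ℝ f)) (x + r • a) a a a) r := fun r hr =>
    hasDerivAt_fderiv_fderiv_line hD hc (hmem r hr) a a
  -- From `P' ≤ 2 P^(3/2) ≤ 2 (P + ε)^(3/2)`, the derivative of `(P + ε)^(-1/2)` is at least `-1`,
  -- so `q` is monotone.
  set q : ℝ → ℝ := fun r => (√(P r + ε))⁻¹ + r with hq
  have hqd : ∀ r ∈ Set.Icc (0 : ℝ) 1, ∃ q', HasDerivAt q q' r ∧ 0 ≤ q' := by
    intro r hr
    have hpos : 0 < P r + ε := by linarith [hPnn r hr]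
    have hs : 0 < √(P r + ε) := Real.sqrt_pos.2 hpos
    refine ⟨_, ((((hd r hr).add_const ε).sqrt hpos.ne').inv hs.ne').add (hasDerivAt_id r), ?_⟩
    have hb := (abs_le.1 (hf.abs_third_fderiv_le (hmem r hr) a a)).2
    change _ ≤ 2 * √(P r) * P r at hb
    have hs2 : √(P r + ε) ^ 2 = P r + ε := Real.sq_sqrt hpos.le
    have hle : √(P r) ≤ √(P r + ε) := Real.sqrt_le_sqrt (by linarith)
    have hle2 : 2 * √(P r) * P r ≤ 2 * √(P r + ε) ^ 3 := by
      have := Real.sq_sqrt (hPnn r hr)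
      have h3 := pow_le_pow_left₀ (Real.sqrt_nonneg (P r)) hle 3
      calc 2 * √(P r) * P r = 2 * √(P r) ^ 3 := by rw [pow_succ, this]; ring
        _ ≤ _ := by linarith
    generalize fderiv ℝ (fderiv ℝ (fderiv ℝ f)) (x + r • a) a a a = T at *
    generalize √(P r + ε) = S at *
    have : T / (2 * S) / S ^ 2 ≤ 1 := by
      rw [div_div, div_le_one (by positivity)]
      nlinarith
    rw [neg_div]
    linarith
  have hmono : MonotoneOn q (Set.Icc 0 1) := by
    refine monotoneOn_of_deriv_nonneg (convex_Icc 0 1)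
      (fun r hr => ?_) (fun r hr => ?_) (fun r hr => ?_)
    · obtain ⟨_, h, _⟩ := hqd r hr
      exact h.continuousAt.continuousWithinAt
    · obtain ⟨_, h, _⟩ := hqd r (interior_subset hr)
      exact h.differentiableAt.differentiableWithinAt
    · obtain ⟨_, h, h'⟩ := hqd r (interior_subset hr)
      rwa [h.deriv]
  have hfin := hmono (show (0 : ℝ) ∈ Set.Icc (0 : ℝ) 1 by simp) ⟨h0, h1⟩ h0
  have hq0 : q 0 = lam⁻¹ := by
    simp only [hq, hε, add_sub_cancel, add_zero]
    rw [Real.sqrt_sq hlam0.le]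
  have hpos : 0 < P τ + ε := by linarith [hPnn τ ⟨h0, h1⟩]
  have hs : 0 < √(P τ + ε) := Real.sqrt_pos.2 hpos
  have hden : 0 < 1 - τ * lam := by nlinarith
  have hle : √(P τ + ε) ≤ lam / (1 - τ * lam) := by
    rw [hq0] at hfin
    have h2 : (1 - τ * lam) / lam ≤ (√(P τ + ε))⁻¹ := by
      have : (1 - τ * lam) / lam = lam⁻¹ - τ := by field_simp
      rw [this]
      simp only [hq] at hfin
      linarith
    have := inv_anti₀ (by positivity) h2
    rwa [inv_inv, inv_div] at this
  exact (Real.sqrt_le_sqrt (by simp only [hP]; linarith)).trans hle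

/-- Along the segment the Hessian form grows at rate at most `2 lam / (1 - r lam)` times itself,
which the factor `(1 - r lam)²` exactly offsets. -/
theorem IsSelfConcordantBarrier.hessForm_le_of_lt (hf : IsSelfConcordantBarrier D f ν)
    {x y : EuclideanSpace ℝ (Fin n)} (hx : x ∈ D) (hy : y ∈ D) {lam : ℝ}
    (hlt : localNorm f x (y - x) < lam) (hlam : lam < 1) (p : EuclideanSpace ℝ (Fin n)) :
    hessForm f y p * (1 - lam) ^ 2 ≤ hessForm f x p := by
  have hD := hf.selfConcordant.isOpen
  have hc := hf.selfConcordant.contDiffOn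
  have hlam0 : 0 < lam := (Real.sqrt_nonneg _).trans_lt hlt
  have hmem : ∀ r ∈ Set.Icc (0 : ℝ) 1, x + r • (y - x) ∈ D := fun r hr =>
    segment_mem hf.selfConcordant.convex hx hy hr.1 hr.2
  set q : ℝ → ℝ := fun r => hessForm f (x + r • (y - x)) p * (1 - r * lam) ^ 2 with hq
  have hqd : ∀ r ∈ Set.Icc (0 : ℝ) 1, ∃ q', HasDerivAt q q' r ∧ q' ≤ 0 := by
    intro r hr
    have h1 : HasDerivAt (fun r : ℝ => (1 - r * lam) ^ 2) (2 * (1 - r * lam) * (-lam)) r := by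
      have h2 : HasDerivAt (fun r : ℝ => (1 - r * lam) ^ 2) _ r :=
        (((hasDerivAt_id r).mul_const lam).const_sub 1).pow 2
      convert h2 using 1
      simp
    refine ⟨_, (hasDerivAt_fderiv_fderiv_line hD hc (hmem r hr) p p).mul h1, ?_⟩
    have hb := (abs_le.1 (hf.abs_third_fderiv_le (hmem r hr) (y - x) p)).2
    have hl := hf.localNorm_segment_le hx hy hlt hlam hr.1 hr.2
    have hnn := hf.hessForm_nonneg (hmem r hr) p
    have hden : 0 < 1 - r * lam := by nlinarith [hr.2]
    rw [le_div_iff₀ hden] at hl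
    change _ + hessForm f (x + r • (y - x)) p * _ ≤ 0
    set N := localNorm f (x + r • (y - x)) (y - x)
    set h := hessForm f (x + r • (y - x)) p
    set T := fderiv ℝ (fderiv ℝ (fderiv ℝ f)) (x + r • (y - x)) (y - x) p p
    have e1 : T * (1 - r * lam) ≤ 2 * h * lam := by
      nlinarith [mul_le_mul_of_nonneg_right hb hden.le, mul_le_mul_of_nonneg_left hl hnn]
    nlinarith [mul_le_mul_of_nonneg_right e1 hden.le]
  have hanti : AntitoneOn q (Set.Icc 0 1) := by
    refine antitoneOn_of_deriv_nonpos (convex_Icc 0 1)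
      (fun r hr => ?_) (fun r hr => ?_) (fun r hr => ?_)
    · obtain ⟨_, h, _⟩ := hqd r hr
      exact h.continuousAt.continuousWithinAt
    · obtain ⟨_, h, _⟩ := hqd r (interior_subset hr)
      exact h.differentiableAt.differentiableWithinAt
    · obtain ⟨_, h, h'⟩ := hqd r (interior_subset hr)
      rwa [h.deriv]
  have := hanti (show (0 : ℝ) ∈ Set.Icc (0 : ℝ) 1 by simp)
    (show (1 : ℝ) ∈ Set.Icc (0 : ℝ) 1 by simp) zero_le_one
  simpa [hq] using this

/-- Comparison of Hessians inside the Dikin ellipsoid. -/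
theorem IsSelfConcordantBarrier.localNorm_le (hf : IsSelfConcordantBarrier D f ν)
    {x y : EuclideanSpace ℝ (Fin n)} (hx : x ∈ D) (hy : y ∈ D)
    (hlt : localNorm f x (y - x) < 1) (p : EuclideanSpace ℝ (Fin n)) :
    localNorm f y p ≤ localNorm f x p / (1 - localNorm f x (y - x)) := by
  set lam := localNorm f x (y - x) with hlam
  have hsq : hessForm f y p * (1 - lam) ^ 2 ≤ hessForm f x p := by
    have hc : Continuous fun l : ℝ => hessForm f y p * (1 - l) ^ 2 := by fun_prop
    -- The bound is available for `l` strictly above the local length; let `l` decrease to it.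
    refine le_of_tendsto ((hc.tendsto lam).mono_left nhdsWithin_le_nhds : Tendsto _ (𝓝[>] lam) _) ?_
    filter_upwards [Ioo_mem_nhdsGT hlt] with l hl
    exact hf.hessForm_le_of_lt hx hy hl.1 hl.2 p
  rw [le_div_iff₀ (by linarith)]
  refine Real.le_sqrt_of_sq_le ?_
  rwa [mul_pow, localNorm, Real.sq_sqrt (hf.hessForm_nonneg hy p)]

/-- A `ν`-self-concordant barrier satisfies `∇f(x)ᵀ(y - x) ≤ ν`. -/
theorem IsSelfConcordantBarrier.fderiv_sub_le (hf : IsSelfConcordantBarrier D f ν)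
    {x y : EuclideanSpace ℝ (Fin n)} (hx : x ∈ D) (hy : y ∈ closure D) :
    fderiv ℝ f x (y - x) ≤ ν := by
  have hD := hf.selfConcordant.isOpen
  have hc := hf.selfConcordant.contDiffOn
  have hν := hf.pos
  by_contra! hlt
  set φ : ℝ → ℝ := fun r => fderiv ℝ f (x + r • (y - x)) (y - x) with hφ
  have hφ0 : φ 0 = fderiv ℝ f x (y - x) := by simp [hφ]
  have hmem : ∀ r ∈ Set.Ico (0 : ℝ) 1, x + r • (y - x) ∈ D := fun r hr => by
    have := hf.selfConcordant.convex.combo_interior_closure_mem_interior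
      (hD.interior_eq.symm ▸ hx) hy (sub_pos.2 hr.2) hr.1 (sub_add_cancel 1 r)
    rw [hD.interior_eq] at this
    convert this using 1
    module
  have hd : ∀ r ∈ Set.Ico (0 : ℝ) 1,
      HasDerivAt φ (hessForm f (x + r • (y - x)) (y - x)) r := fun r hr =>
    hasDerivAt_fderiv_line hD hc (hmem r hr) (y - x)
  have hφmono : MonotoneOn φ (Set.Ico 0 1) := by
    refine monotoneOn_of_deriv_nonneg (convex_Ico 0 1)
      (fun r hr => (hd r hr).continuousAt.continuousWithinAt)
      (fun r hr => (hd r (interior_subset hr)).differentiableAt.differentiableWithinAt)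
      (fun r hr => ?_)
    rw [(hd r (interior_subset hr)).deriv]
    exact hf.hessForm_nonneg (hmem r (interior_subset hr)) _
  have hφpos : ∀ r ∈ Set.Ico (0 : ℝ) 1, 0 < φ r := fun r hr => by
    have := hφmono (show (0 : ℝ) ∈ Set.Ico (0 : ℝ) 1 by simp) hr hr.1
    linarith
  -- The gradient bound reads `φ² ≤ ν φ'`, so `ν/φ + r` is nonincreasing. A slope `φ 0 > ν` would
  -- have to blow up by time `ν / φ 0 < 1`, while the segment is still inside `D`.
  set q : ℝ → ℝ := fun r => ν * (φ r)⁻¹ + r with hq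
  have hqd : ∀ r ∈ Set.Ico (0 : ℝ) 1, ∃ q', HasDerivAt q q' r ∧ q' ≤ 0 := fun r hr => by
    refine ⟨_, (((hd r hr).inv (hφpos r hr).ne').const_mul ν).add (hasDerivAt_id r), ?_⟩
    have h1 := hf.sq_fderiv_le (hmem r hr) (y - x)
    have h2 := hφpos r hr
    change φ r ^ 2 ≤ _ at h1
    have h3 := (one_le_div (by positivity)).2 h1
    have h4 : ν * (-hessForm f (x + r • (y - x)) (y - x) / φ r ^ 2) =
      -(ν * hessForm f (x + r • (y - x)) (y - x) / φ r ^ 2) := by ring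
    linarith
  have hanti : AntitoneOn q (Set.Ico 0 1) := by
    refine antitoneOn_of_deriv_nonpos (convex_Ico 0 1)
      (fun r hr => ?_) (fun r hr => ?_) (fun r hr => ?_)
    · obtain ⟨_, h, _⟩ := hqd r hr
      exact h.continuousAt.continuousWithinAt
    · obtain ⟨_, h, _⟩ := hqd r (interior_subset hr)
      exact h.differentiableAt.differentiableWithinAt
    · obtain ⟨_, h, h'⟩ := hqd r (interior_subset hr)
      rwa [h.deriv]
  have hτ : ν / φ 0 ∈ Set.Ico (0 : ℝ) 1 := by
    rw [hφ0]
    exact ⟨div_nonneg hν.le (by linarith), (div_lt_one (by linarith)).2 hlt⟩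
  have h1 := hanti (show (0 : ℝ) ∈ Set.Ico (0 : ℝ) 1 by simp) hτ hτ.1
  simp only [hq, ← div_eq_mul_inv, add_zero] at h1
  have h2 : 0 < ν / φ (ν / φ 0) := div_pos hν (hφpos _ hτ)
  linarith

end Barrier

end ProxPath

/-! ### Optimality, feasibility of the iterates, and one inexact step -/

namespace ProxPath

variable {n : ℕ} {D : Set (EuclideanSpace ℝ (Fin n))} {f : EuclideanSpace ℝ (Fin n) → ℝ}
  {g : EuclideanSpace ℝ (Fin n) → EReal} {ν t : ℝ}

theorem IsProperLscConvex.coe_toReal (hg : IsProperLscConvex g) {x : EuclideanSpace ℝ (Fin n)}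
    (hx : g x < ⊤) : ((g x).toReal : EReal) = g x :=
  EReal.coe_toReal hx.ne (hg.ne_bot x)

theorem IsProperLscConvex.le_segment (hg : IsProperLscConvex g) {x y : EuclideanSpace ℝ (Fin n)}
    (hx : g x < ⊤) (hy : g y < ⊤) {s : ℝ} (h0 : 0 ≤ s) (h1 : s ≤ 1) :
    g (x + s • (y - x)) ≤
      (((g x).toReal + s * ((g y).toReal - (g x).toReal) : ℝ) : EReal) := by
  have mx : (x, (g x).toReal) ∈ {p : EuclideanSpace ℝ (Fin n) × ℝ | g p.1 ≤ (p.2 : EReal)} :=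
    (hg.coe_toReal hx).ge
  have my : (y, (g y).toReal) ∈ {p : EuclideanSpace ℝ (Fin n) × ℝ | g p.1 ≤ (p.2 : EReal)} :=
    (hg.coe_toReal hy).ge
  exact hg.convex_epigraph.add_smul_sub_mem mx my ⟨h0, h1⟩

theorem IsProperLscConvex.segment_lt_top (hg : IsProperLscConvex g)
    {x y : EuclideanSpace ℝ (Fin n)} (hx : g x < ⊤) (hy : g y < ⊤) {s : ℝ} (h0 : 0 ≤ s)
    (h1 : s ≤ 1) : g (x + s • (y - x)) < ⊤ :=
  (hg.le_segment hx hy h0 h1).trans_lt (EReal.coe_lt_top _)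

/-- First-order optimality of a solution of the penalized problem, tested in a point of the closure
of the domain. -/
theorem IsPenalizedSolution.toReal_sub_le (hf : IsSelfConcordant D f)
    (hg : IsProperLscConvex g) (ht : 0 < t) {xt z : EuclideanSpace ℝ (Fin n)}
    (hxt : IsPenalizedSolution D f g t xt) (hz : z ∈ closure D) (hgz : g z < ⊤) :
    (g xt).toReal - (g z).toReal ≤ t * fderiv ℝ f xt (z - xt) := by
  obtain ⟨⟨hxD, hgx⟩, hmin⟩ := hxt
  have hgx : g xt < ⊤ := hgx
  have hx0 : xt + (0 : ℝ) • (z - xt) ∈ D := by simpa using hxD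
  have hd := hasDerivAt_comp_line
    (differentiableAt_fderiv_fderiv hf.isOpen hf.contDiffOn hx0).1
  have hlim := hd.tendsto_slope_zero_right
  simp only [zero_smul, add_zero, zero_add] at hlim
  -- Minimality at `xt` and convexity of `g` bound the difference quotients of `f` from below. The
  -- points used lie in `D` even if `z` is on the boundary.
  have hev : ∀ᶠ s : ℝ in 𝓝[>] 0, t⁻¹ * ((g xt).toReal - (g z).toReal) ≤
      s⁻¹ • (f (xt + s • (z - xt)) - f xt) := by
    filter_upwards [Ioo_mem_nhdsGT (zero_lt_one' ℝ)] with s hs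
    have hmem : xt + s • (z - xt) ∈ D := by
      have := hf.convex.combo_interior_closure_mem_interior
        (hf.isOpen.interior_eq.symm ▸ hxD) hz (sub_pos.2 hs.2) hs.1.le (sub_add_cancel 1 s)
      rw [hf.isOpen.interior_eq] at this
      convert this using 1
      module
    have hlt := hg.segment_lt_top hgx hgz hs.1.le hs.2.le
    have hle := hg.le_segment hgx hgz hs.1.le hs.2.le
    rw [← hg.coe_toReal hlt, EReal.coe_le_coe_iff] at hle
    have hm : penalized f g t xt ≤ penalized f g t (xt + s • (z - xt)) := hmin ⟨hmem, hlt⟩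
    simp only [penalized] at hm
    have := mul_le_mul_of_nonneg_left hle (inv_pos.2 ht).le
    rw [smul_eq_mul, le_inv_mul_iff₀ hs.1]
    linarith
  have := ge_of_tendsto hlim hev
  rwa [inv_mul_le_iff₀ ht] at this

theorem IsPenalizedSolution.toReal_sub_le_barrier (hf : IsSelfConcordantBarrier D f ν)
    (hg : IsProperLscConvex g) (ht : 0 < t) {xt z : EuclideanSpace ℝ (Fin n)}
    (hxt : IsPenalizedSolution D f g t xt) (hz : z ∈ closure D) (hgz : g z < ⊤) :
    (g xt).toReal - (g z).toReal ≤ t * ν :=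
  (hxt.toReal_sub_le hf.selfConcordant hg ht hz hgz).trans
    (mul_le_mul_of_nonneg_left (hf.fderiv_sub_le hxt.1.1 hz) ht.le)

/-- The damped step has length in `[0, 1]`, so each iterate is a convex combination of two points of
`dom F`. -/
theorem PathFollowingRun.z_mem (hf : IsSelfConcordant D f) (hg : IsProperLscConvex g)
    (r : PathFollowingRun D f g ν) : ∀ j ≤ r.J, r.z j ∈ domF D g := by
  intro j
  induction j with
  | zero => exact fun _ => r.z_zero_mem
  | succ j ih =>
    intro hj
    obtain ⟨hzD, hzg⟩ := ih (by omega)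
    obtain ⟨⟨hsD, hsg⟩, _⟩ := r.trial j (by omega)
    rw [r.damped_step j (by omega)]
    have hκ := r.κ_lt_one
    have hκ' := r.κ_pos
    have hp : 0 ≤ (1 - r.κ) * localNorm f (r.z j) (r.s j - r.z j) :=
      mul_nonneg (by linarith) (Real.sqrt_nonneg _)
    have h0 : 0 ≤ (1 - r.κ) / (1 + (1 - r.κ) * localNorm f (r.z j) (r.s j - r.z j)) :=
      div_nonneg (by linarith) (by linarith)
    have h1 : (1 - r.κ) / (1 + (1 - r.κ) * localNorm f (r.z j) (r.s j - r.z j)) ≤ 1 :=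
      (div_le_one (by linarith)).2 (by linarith)
    exact ⟨segment_mem hf.convex hzD hsD h0 h1, hg.segment_lt_top hzg hsg h0 h1⟩

theorem PathFollowingRun.x_mem (hf : IsSelfConcordant D f) (hg : IsProperLscConvex g)
    (r : PathFollowingRun D f g ν) {k : ℕ} (hk : k ≤ r.K) : r.x k ∈ domF D g := by
  cases k with
  | zero => exact r.x_zero ▸ r.z_mem hf hg r.J le_rfl
  | succ k => exact (r.x_succ k (by omega)).1

/-- `‖a‖² - ‖p - a‖² = 2⟨a, p⟩ - ‖p‖²`, followed by Cauchy–Schwarz, obtained from the discriminant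
of `s ↦ ‖s p - a‖²`. Used with `a = c - x*_t` and `p = y - x*_t`. -/
theorem IsSelfConcordantBarrier.hessForm_inner_le (hf : IsSelfConcordantBarrier D f ν)
    {x : EuclideanSpace ℝ (Fin n)} (hx : x ∈ D) (a p : EuclideanSpace ℝ (Fin n)) :
    hessForm f x a - hessForm f x (p - a) ≤ 2 * (localNorm f x a * localNorm f x p) := by
  set b := fderiv ℝ (fderiv ℝ f) x a p with hb
  have hsymm : fderiv ℝ (fderiv ℝ f) x p a = b :=
    fderiv_fderiv_comm hf.selfConcordant.isOpen hf.selfConcordant.contDiffOn hx p a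
  have hexp : ∀ s : ℝ, hessForm f x (s • p - a) =
      s ^ 2 * hessForm f x p - 2 * s * b + hessForm f x a := fun s => by
    simp only [hessForm, map_sub, map_smul, sub_apply, smul_apply, smul_eq_mul, hsymm, ← hb]
    ring
  have hd := discrim_le_zero (a := hessForm f x p) (b := -2 * b) (c := hessForm f x a)
    (fun s => by nlinarith [hexp s, hf.hessForm_nonneg hx (s • p - a)])
  have hcs : b ≤ localNorm f x a * localNorm f x p := by
    rw [localNorm, localNorm, ← Real.sqrt_mul (hf.hessForm_nonneg hx a)]
    refine Real.le_sqrt_of_sq_le ?_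
    rw [discrim] at hd
    linarith
  have h1 := hexp 1
  rw [one_smul] at h1
  linarith [hf.hessForm_nonneg hx p]

/-- One inexact proximal-Newton step: the gap in `g` between the inexact solution and the solution
of the penalized problem. -/
theorem IsInexactSolution.toReal_sub_le (hf : IsSelfConcordantBarrier D f ν) (ht : 0 < t) {δ : ℝ}
    (hδ : 0 ≤ δ) {c y xt : EuclideanSpace ℝ (Fin n)} (hc : c ∈ D) (hxt : xt ∈ domF D g)
    (hy : IsInexactSolution D f g t δ c y) (hlt : localNorm f xt (c - xt) < 1) :
    (g y).toReal - (g xt).toReal ≤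
      t * gapBound ν (localNorm f xt (c - xt)) (localNorm f xt (y - xt)) δ := by
  have hmod := hy.2 xt hxt
  simp only [compositeModel, quadModel] at hmod
  have hin := hf.hessForm_inner_le hc (c - xt) (y - xt)
  have ha := hf.localNorm_le hxt.1 hc hlt (c - xt)
  have hp := hf.localNorm_le hxt.1 hc hlt (y - xt)
  have hgrad := (abs_le.1 (hf.abs_fderiv_le hc (y - xt))).1
  have e1 : y - xt - (c - xt) = y - c := by abel
  have e2 : hessForm f c (xt - c) = hessForm f c (c - xt) := by
    rw [← neg_sub c xt]; simp only [hessForm, map_neg, neg_apply, neg_neg]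
  have e3 : fderiv ℝ f c (y - xt) = fderiv ℝ f c (y - c) - fderiv ℝ f c (xt - c) := by
    rw [← map_sub]; congr 1; abel
  rw [e1] at hin
  rw [e2] at hmod
  rw [e3] at hgrad
  have hl0 : 0 ≤ localNorm f xt (c - xt) := Real.sqrt_nonneg _
  have hp0 : 0 ≤ localNorm f xt (y - xt) := Real.sqrt_nonneg _
  have hcp0 : 0 ≤ localNorm f c (y - xt) := Real.sqrt_nonneg _
  generalize localNorm f xt (c - xt) = l at *
  generalize localNorm f xt (y - xt) = m at *
  have hden : 0 < 1 - l := by linarith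
  have hprod : localNorm f c (c - xt) * localNorm f c (y - xt) ≤
      l / (1 - l) ^ 2 * (m + l + δ) := by
    calc localNorm f c (c - xt) * localNorm f c (y - xt) ≤ l / (1 - l) * (m / (1 - l)) :=
          mul_le_mul ha hp hcp0 (by positivity)
      _ = l / (1 - l) ^ 2 * m := by field_simp
      -- The sharper `l m / (1 - l)²` is enlarged here to the form in `gapBound`.
      _ ≤ _ := mul_le_mul_of_nonneg_left (by linarith) (by positivity)
  have hs := mul_le_mul_of_nonneg_left hp (Real.sqrt_nonneg ν)
  rw [← inv_mul_le_iff₀ ht, gapBound]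
  linarith

end ProxPath

/-! ### The lemma -/

theorem lemma5p1 {n : ℕ} (Ω D : Set (EuclideanSpace ℝ (Fin n)))
    (f : EuclideanSpace ℝ (Fin n) → ℝ) (g : EuclideanSpace ℝ (Fin n) → EReal) (ν : ℝ)
    (hf : ProxPath.IsSelfConcordantBarrier D f ν) (hΩ : closure D = Ω)
    (hg : ProxPath.IsProperLscConvex g)
    (xopt : EuclideanSpace ℝ (Fin n)) (hxopt : ProxPath.IsConstrainedSolution Ω g xopt) :
    (∀ t : ℝ, 0 < t → ∀ xt : EuclideanSpace ℝ (Fin n), ProxPath.IsPenalizedSolution D f g t xt →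
      xt ∈ interior Ω ∧ 0 ≤ g xt - g xopt ∧ g xt - g xopt ≤ ((t * ν : ℝ) : EReal)) ∧
    (∀ r : ProxPath.PathFollowingRun D f g ν,
      (∀ k ≤ r.K,
        0 ≤ g (r.x k) - g xopt ∧
        ∀ xt : EuclideanSpace ℝ (Fin n), ProxPath.IsPenalizedSolution D f g (r.t k) xt →
          ((-(ν * r.t k) : ℝ) : EReal) ≤ g (r.x k) - g xt) ∧
      (∀ k < r.K, ∀ xt : EuclideanSpace ℝ (Fin n),
        ProxPath.IsPenalizedSolution D f g (r.t (k + 1)) xt →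
        ∀ lam lamPlus : ℝ,
          lam = ProxPath.localNorm f xt (r.x k - xt) →
          lamPlus = ProxPath.localNorm f xt (r.x (k + 1) - xt) →
          lam < 1 →
          g (r.x (k + 1)) - g xt
              ≤ ((r.t (k + 1) * ProxPath.gapBound ν lam lamPlus (r.δ (k + 1)) : ℝ) : EReal) ∧
          g (r.x (k + 1)) - g xopt
              ≤ ((r.t (k + 1) * ProxPath.psi ν lam lamPlus (r.δ (k + 1)) : ℝ) : EReal))) := by
  subst hΩ
  have hsc := hf.selfConcordant
  obtain ⟨hoptD, hopt⟩ := hxopt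
  have hcoe : ∀ x y, g x < ⊤ → g y < ⊤ → g x - g y = (((g x).toReal - (g y).toReal : ℝ) : EReal) :=
    fun x y hx hy => by
      rw [EReal.coe_sub, hg.coe_toReal hx, hg.coe_toReal hy]
  -- Any point of `dom F` forces `g xopt` to be finite, so the differences in `EReal` become real
  -- ones.
  have hopt_top : ∀ y ∈ ProxPath.domF D g, g xopt < ⊤ := fun y hy =>
    (show g xopt ≤ g y from hopt (subset_closure hy.1)).trans_lt hy.2
  have hopt_le : ∀ y ∈ ProxPath.domF D g, 0 ≤ g y - g xopt := fun y hy => by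
    have h : g xopt ≤ g y := hopt (subset_closure hy.1)
    have h' := hopt_top y hy
    rw [← hg.coe_toReal h', ← hg.coe_toReal hy.2, EReal.coe_le_coe_iff] at h
    rw [hcoe _ _ hy.2 h', EReal.coe_nonneg]
    linarith
  refine ⟨fun t ht xt hxt => ⟨?_, hopt_le xt hxt.1, ?_⟩, fun r => ⟨fun k hk => ?_, ?_⟩⟩
  · exact interior_maximal subset_closure hsc.isOpen hxt.1.1
  · have h' := hopt_top xt hxt.1
    rw [hcoe _ _ hxt.1.2 h', EReal.coe_le_coe_iff]
    exact hxt.toReal_sub_le_barrier hf hg ht hoptD h'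
  · have hx := r.x_mem hsc hg hk
    refine ⟨hopt_le _ hx, fun xt hxt => ?_⟩
    rw [hcoe _ _ hx.2 hxt.1.2, EReal.coe_le_coe_iff]
    have := hxt.toReal_sub_le_barrier hf hg (r.t_pos k hk) (subset_closure hx.1) hx.2
    linarith
  · rintro k hk xt hxt lam lamPlus rfl rfl hlt
    have hx := r.x_mem hsc hg (k := k + 1) hk
    have hc := r.x_mem hsc hg hk.le
    have ht := r.t_pos (k + 1) hk
    have h' := hopt_top xt hxt.1
    have h1 := (r.x_succ k hk).toReal_sub_le hf ht (r.δ_nonneg k hk) hc.1 hxt.1 hlt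
    have h2 := hxt.toReal_sub_le_barrier hf hg ht hoptD h'
    rw [hcoe _ _ hx.2 hxt.1.2, hcoe _ _ hx.2 h', EReal.coe_le_coe_iff, EReal.coe_le_coe_iff]
    refine ⟨h1, ?_⟩
    rw [ProxPath.gapBound] at h1
    rw [ProxPath.psi]
    linarith
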